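/- Let $\gamma>0$ and $r>0$. For a real $N\times N$ matrix $\mathcal L_N$ consider the system of $N$ second-order agents $\ddot x=-r\mathcal L_Nx-\gamma r\mathcal L_N\dot x$ with relative velocity gain $\gamma$; it \emph{reaches consensus} if $\|(x_i(t)-x_k(t),\dot x_i(t)-\dot x_k(t))\|\to0$ as $t\to\infty$ for all agents $i,k$ and all initial conditions. The Laplacian matrix of a digraph with adjacency (multiplicity or weight) matrix $(a_{ik})$ has the off-diagonal entries $-a_{ik}$ and zero row sums. Cyclic topologies. Let $n\ge1$ and $S\subseteq\{1,\dots,n-1\}$. For $m\ge1$ the ring digraph $\mathcal G_{m,n}(S)$ on $N=mn$ nodes consists of $m$ identical macro-vertices with nodes $v^i_1,\dots,v^i_n$ $(i=1,\dots,m)$, the arcs $v^i_{k+1}\to v^i_k$ $(1\le k\le n-1)$ and $v^i_k\to v^i_{k+1}$ $(k\in S)$, and the linking arcs $v^{i+1}_1\to v^i_n$ ($i$ modulo $m$); for $n=1$ it is the Hamiltonian cycle. The weighted ring with parameter $c\in[0,1]$ on $N$ nodes has arcs $i\to i-1$ of weight $1$ and $i\to i+1$ of weight $c$ (modulo $N$).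 Sets in the plane $\mathbb C=\{x+\mathrm jy\}$: (1) the unit circle $(x-1)^2+y^2=1$; (2) the Cassini ovals $[(\tilde x-\sqrt5)^2+\tilde y^2][(\tilde x+\sqrt5)^2+\tilde y^2]=16$ with $\tilde x=2(x-\tfrac32)$, $\tilde y=2y$; (3) the sextic $(\tilde x^2+y^2)^3+(4+4\tilde x)(\tilde x^2+y^2)^2-2\tilde x^3-4\tilde x^2+6\tilde xy^2+4y^2=0$ with $\tilde x=x-2$; (4) the sextic $(\tilde x^2+y^2)^3+2\tilde x(\tilde x^2+y^2)^2-3\tilde x^4-6\tilde x^3+2\tilde x^2y^2+2\tilde x^2+2\tilde xy^2+4\tilde x+5y^4+6y^2=0$ with $\tilde x=x-2$; (5) the drop region $\{0\le x\le4,\ |y|\le f(x)\}$, where $f(x)=\sqrt{1-(x-1)^2}$ for $x\in[0,\tfrac32]$ and $f(x)=\tfrac1{\sqrt2}(3-\sqrt{1+2x})\sqrt{\sqrt{1+2x}-x+1}$ for $x\in(\tfrac32,4]$; its boundary curve is $y=\pm f(x)$, $x\in[0,4]$. Then the following holds. (a) No cyclic topology with Laplacian spectrum in one of these sets guarantees consensus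 for all numbers of agents; more precisely: if, for some $n$ and $S$, the Laplacian spectra of $\mathcal G_{m,n}(S)$ lie for all $m\ge1$ in one of the sets (1)--(5), then the system over $\mathcal G_{m,n}(S)$ fails to reach consensus for all sufficiently large $m$; and for every fixed $c\in[0,1)$ the system over the weighted ring with parameter $c$ fails to reach consensus for all sufficiently large $N$. Here the spectra of $\mathcal G_{m,1}(\emptyset)$, $\mathcal G_{m,2}(\{1\})$, $\mathcal G_{m,3}(\{1\})$, $\mathcal G_{m,3}(\{1,2\})$ lie in (1), (2), (3), (4), respectively, for all $m\ge1$, and the spectra of the weighted rings lie in (5) for all $c\in[0,1]$ and $N\ge1$. (b) Let $\Omega=\{\lambda\in\mathbb C: s^2/(1+\gamma s)\ne\lambda \text{ whenever } \operatorname{Re}s\ge0\}$ be the consensus region. Its boundary is the curve $y^2=-\gamma^2x^3/(\gamma^2x+1)$. (c) Let $K$ be any of the curves (1)--(4) or the boundary curve of (5), and let $K'=-rK$, i.e. $K$ reflected about the vertical axis and scaled by $r$. Then $0\in K'$; for every $\varepsilon>0$ and all negative $x$ sufficiently close to $0$ there is $y\in(0,\varepsilon)$ with $x+\mathrm jy\in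 K'$; and every point $x+\mathrm jy\ne0$ of $K'$ sufficiently close to the origin satisfies $x<0$, $\gamma^2x+1>0$, $y^2>-\gamma^2x^3/(\gamma^2x+1)$ and does not belong to $\Omega$. -/

import Mathlib

open Filter Topology

noncomputable section

/-- The Laplacian matrix of the digraph with (weighted) adjacency matrix `a`; loops are ignored. -/
def digraphLaplacian {V : Type*} [Fintype V] [DecidableEq V] (a : Matrix V V ℝ) : Matrix V V ℝ :=
  Matrix.of fun i k => if i = k then ∑ l ∈ Finset.univ.erase i, a i l else -a i k

/-- The adjacency matrix of the ring digraph made of `m` identical linear macro-vertices on `n`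
nodes; `(i, j)` is the `j`-th node of the `i`-th macro-vertex (both counted from `0`). The entry
at `(p, q)` is the number of arcs from `p` to `q`. The three summands count, in this order,
the main-direction arcs `(i, j + 1) → (i, j)`,
the reverse arcs `(i, j) → (i, j + 1)`, which are present exactly for `j ∈ S`, and
the linking arcs `(i + 1, 0) → (i, n - 1)`, with `i + 1` taken modulo `m`. -/
def ringAdjacency (m n : ℕ) (S : Finset ℕ) : Matrix (Fin m × Fin n) (Fin m × Fin n) ℝ :=
  Matrix.of fun p q =>
    (if p.1 = q.1 ∧ p.2.val = q.2.val + 1 then 1 else 0)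
    + (if p.1 = q.1 ∧ p.2.val ∈ S ∧ q.2.val = p.2.val + 1 then 1 else 0)
    + (if p.1.val = (q.1.val + 1) % m ∧ p.2.val = 0 ∧ q.2.val + 1 = n then 1 else 0)

/-- The Laplacian matrix of the ring digraph. For `n = 1` it is the Hamiltonian cycle on `m`
nodes (cyclic pursuit). -/
def ringLaplacian (m n : ℕ) (S : Finset ℕ) : Matrix (Fin m × Fin n) (Fin m × Fin n) ℝ :=
  digraphLaplacian (ringAdjacency m n S)

/-- The weighted necklace digraph on `N` nodes: the Hamiltonian cycle `i → i - 1` with arcs of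
weight `1`, and the inverse cycle `i → i + 1` with arcs of weight `c` (indices modulo `N`). -/
def weightedRingAdjacency (N : ℕ) (c : ℝ) : Matrix (Fin N) (Fin N) ℝ :=
  Matrix.of fun i k =>
    (if i.val = (k.val + 1) % N then 1 else 0) + (if k.val = (i.val + 1) % N then c else 0)

/-- The Laplacian matrix of the weighted necklace digraph. -/
def weightedRingLaplacian (N : ℕ) (c : ℝ) : Matrix (Fin N) (Fin N) ℝ :=
  digraphLaplacian (weightedRingAdjacency N c)

/-- The set of complex eigenvalues of a real matrix. -/
def complexSpectrum {V : Type*} [Fintype V] [DecidableEq V] (L : Matrix V V ℝ) : Set ℂ :=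
  spectrum ℂ (L.map ((↑) : ℝ → ℂ))

/-- `x`, with velocity `v`, solves `x'' = - r L x - γ r L x'` on `[0, ∞)`. -/
def IsSolution {V : Type*} [Fintype V] (γ r : ℝ) (L : Matrix V V ℝ) (x v : ℝ → V → ℝ) : Prop :=
  ∀ t : ℝ, 0 ≤ t →
    HasDerivWithinAt x (v t) (Set.Ici 0) t ∧
    HasDerivWithinAt v (-(r • L.mulVec (x t)) - (γ * r) • L.mulVec (v t)) (Set.Ici 0) t

/-- The system `x'' = - r L x - γ r L x'` reaches consensus: for every initial condition, that is
along every solution, the states `(xᵢ, xᵢ')` of any two agents approach each other. -/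
def ReachesConsensus {V : Type*} [Fintype V] (γ r : ℝ) (L : Matrix V V ℝ) : Prop :=
  ∀ x v : ℝ → V → ℝ, IsSolution γ r L x v →
    ∀ i k : V, Tendsto (fun t : ℝ => ‖!₂[x t i - x t k, v t i - v t k]‖) atTop (𝓝 0)

/-- The consensus region of a generalized frequency variable `φ`. -/
def consensusRegion (φ : ℂ → ℂ) : Set ℂ :=
  {μ | ∀ s : ℂ, 0 ≤ s.re → φ s - μ ≠ 0}

/-- The generalized frequency variable of the system with relative velocity gain `γ`. -/
def relativeVelocityVariable (γ : ℝ) (s : ℂ) : ℂ := s ^ 2 / (1 + (γ : ℂ) * s)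

/-- The curve `y² = - γ² x³ / (γ² x + 1)`. -/
def boundaryCurve (γ : ℝ) : Set ℂ :=
  {z | γ ^ 2 * z.re + 1 ≠ 0 ∧ z.im ^ 2 = -γ ^ 2 * z.re ^ 3 / (γ ^ 2 * z.re + 1)}

/-- The unit circle centred at `1`. -/
def unitCircleAtOne : Set ℂ :=
  {z | (z.re - 1) ^ 2 + z.im ^ 2 - 1 = 0}

/-- The Cassini ovals. -/
def cassiniOvals : Set ℂ :=
  {z | ((2 * (z.re - 3 / 2) - √5) ^ 2 + (2 * z.im) ^ 2)
      * ((2 * (z.re - 3 / 2) + √5) ^ 2 + (2 * z.im) ^ 2) = 2 ^ 4}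

/-- The left-hand side of the equation of the first sextic curve. -/
def sexticOnePoly (x y : ℝ) : ℝ :=
  (x ^ 2 + y ^ 2) ^ 3 + (4 + 4 * x) * (x ^ 2 + y ^ 2) ^ 2 - 2 * x ^ 3 - 4 * x ^ 2
    + 6 * x * y ^ 2 + 4 * y ^ 2

/-- The left-hand side of the equation of the second sextic curve. -/
def sexticTwoPoly (x y : ℝ) : ℝ :=
  (x ^ 2 + y ^ 2) ^ 3 + 2 * x * (x ^ 2 + y ^ 2) ^ 2 - 3 * x ^ 4 - 6 * x ^ 3
    + 2 * x ^ 2 * y ^ 2 + 2 * x ^ 2 + 2 * x * y ^ 2 + 4 * x + 5 * y ^ 4 + 6 * y ^ 2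

/-- The first sextic curve. -/
def sexticOne : Set ℂ := {z | sexticOnePoly (z.re - 2) z.im = 0}

/-- The second sextic curve. -/
def sexticTwo : Set ℂ := {z | sexticTwoPoly (z.re - 2) z.im = 0}

/-- The upper boundary function of the drop-shaped region, meant on `[0, 4]`. -/
def dropFun (x : ℝ) : ℝ :=
  if x ≤ 3 / 2 then √(1 - (x - 1) ^ 2)
  else 1 / √2 * (3 - √(1 + 2 * x)) * √(√(1 + 2 * x) - x + 1)

/-- The boundary curve of the drop-shaped region. -/
def dropCurve : Set ℂ :=
  {z | 0 ≤ z.re ∧ z.re ≤ 4 ∧ (z.im = dropFun z.re ∨ z.im = -dropFun z.re)}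

/-- The drop-shaped region. -/
def dropRegion : Set ℂ :=
  {z | 0 ≤ z.re ∧ z.re ≤ 4 ∧ -dropFun z.re ≤ z.im ∧ z.im ≤ dropFun z.re}

/-- The curve `K`, reflected about the vertical axis and scaled by `r`: where the spectrum of
`- r L` lies when that of `L` lies on `K` (all curves here are symmetric about the real axis). -/
def reflectScale (r : ℝ) (K : Set ℂ) : Set ℂ := (fun z : ℂ => -(r : ℂ) * z) '' K

/-- The curve `K` starts at the origin and leaves the consensus region there:
over every sufficiently small negative abscissa `K` has a point on a positive branch issuing
from the origin, and every point of `K` near the origin, other than the origin itself, lies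
strictly beyond the curve `y² = - γ² x³ / (γ² x + 1)` (above its positive branch or below its
negative one) and outside the consensus region. -/
def LeavesConsensusRegionAtOrigin (γ : ℝ) (K : Set ℂ) : Prop :=
  (0 : ℂ) ∈ K ∧
  (∀ ε > 0, ∃ η > 0, ∀ x : ℝ, -η < x → x < 0 → ∃ y : ℝ, 0 < y ∧ y < ε ∧ (⟨x, y⟩ : ℂ) ∈ K) ∧
  ∃ δ > 0, ∀ z ∈ K, z ≠ 0 → ‖z‖ < δ →
    z.re < 0 ∧ 0 < γ ^ 2 * z.re + 1 ∧
    -γ ^ 2 * z.re ^ 3 / (γ ^ 2 * z.re + 1) < z.im ^ 2 ∧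
    z ∉ consensusRegion (relativeVelocityVariable γ)

end

/-! ### Complex eigenvectors of digraph Laplacians -/

/-! An eigenpair `L u = z u` and a root `s` of `s² = -r z (1 + γ s)` give the solution `Re (exp (s
t) u)`. If `-r z` lies outside the consensus region, some root has `Re s ≥ 0`; consensus then forces
`u` to be constant, hence `L u = 0`, which is impossible for `z ≠ 0`
(`not_reachesConsensus_of_mem_spectrum`). So consensus is lost as soon as one nonzero eigenvalue,
reflected and scaled, leaves the region.

The region is the set where `y² + γ² x (x² + y²) < 0` (`mem_consensusRegion_iff`). At the origin
this is a cusp around the negative real axis, where `y²` is bounded by a quantity of order `|x|³`.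
Whatever approaches the origin tangentially to the imaginary axis must leave it.

Long rings have such eigenvalues. Solving the eigenvalue equations through one macro-vertex
multiplies the last-node value by a polynomial `P(z)`, and `P(z) ^ m = 1` makes `z` an eigenvalue.
Since `P(0) = 1` and `P'(0)` is real and negative, inverting `P` near `1` at the roots of unity `exp
(iθ)`, `θ = 2π/m`, gives eigenvalues `iθ / P'(0) + o(θ)`. For the weighted ring the explicit
eigenvalues behave like `i(1 - c)θ`.

The algebraic curves are the loci `|P(z)| = 1`, while the drop contains a family of filled ellipses
with parameter `c`. All five curves have the local form `y² b = x a` with `a, b > 0`, so they are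
vertical at the origin, with `x` of order `y²`. -/

theorem mem_complexSpectrum_iff {V : Type*} [Fintype V] [DecidableEq V] (L : Matrix V V ℝ) (z : ℂ) :
    z ∈ complexSpectrum L ↔
      ∃ u : V → ℂ, u ≠ 0 ∧ (L.map ((↑) : ℝ → ℂ)).mulVec u = z • u := by
  rw [complexSpectrum, ← Matrix.spectrum_toLin', ← Module.End.hasEigenvalue_iff_mem_spectrum]
  constructor
  · intro h
    obtain ⟨u, hu⟩ := h.exists_hasEigenvector
    exact ⟨u, hu.2, by simpa using hu.apply_eq_smul⟩
  · rintro ⟨u, hu, h⟩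
    exact Module.End.hasEigenvalue_of_hasEigenvector
      (Module.End.hasEigenvector_iff.2 ⟨Module.End.mem_eigenspace_iff.2 (by simpa using h), hu⟩)

/-- In this form the diagonal terms vanish and parallel arcs add up, so loops and coinciding arcs of
very short rings need no separate treatment. -/
theorem digraphLaplacian_map_mulVec {V : Type*} [Fintype V] [DecidableEq V] (a : Matrix V V ℝ)
    (u : V → ℂ) (i : V) :
    ((digraphLaplacian a).map ((↑) : ℝ → ℂ)).mulVec u i = ∑ k, (a i k : ℂ) * (u i - u k) := by
  have h : ∀ k ∈ Finset.univ.erase i,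
      ((digraphLaplacian a i k : ℝ) : ℂ) * u k = -(a i k : ℂ) * u k := by
    intro k hk
    simp [digraphLaplacian, (Finset.ne_of_mem_erase hk).symm]
  rw [Matrix.mulVec, dotProduct, ← Finset.add_sum_erase _ _ (Finset.mem_univ i),
    ← Finset.add_sum_erase (a := i) _ (fun k => (a i k : ℂ) * (u i - u k)) (Finset.mem_univ i)]
  simp only [Matrix.map_apply]
  rw [Finset.sum_congr rfl h]
  simp [digraphLaplacian, mul_sub]
  rw [← Finset.sum_mul]
  ring

theorem digraphLaplacian_map_mulVec_const {V : Type*} [Fintype V] [DecidableEq V]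
    (a : Matrix V V ℝ) (u : V → ℂ) (hu : ∀ i k, u i = u k) :
    ((digraphLaplacian a).map ((↑) : ℝ → ℂ)).mulVec u = 0 := by
  funext i
  rw [digraphLaplacian_map_mulVec]
  exact Finset.sum_eq_zero fun k _ => by rw [hu i k, sub_self, mul_zero]

theorem Matrix.mulVec_map_ofReal_re {V : Type*} [Fintype V] (L : Matrix V V ℝ) (u : V → ℂ) (i : V) :
    L.mulVec (fun k => (u k).re) i = ((L.map ((↑) : ℝ → ℂ)).mulVec u i).re := by
  simp [Matrix.mulVec, dotProduct]

/-! ### Exponential solutions -/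

theorem isSolution_re_exp {V : Type*} [Fintype V] (γ r : ℝ) (L : Matrix V V ℝ)
    (u : V → ℂ) (z s : ℂ) (hu : (L.map ((↑) : ℝ → ℂ)).mulVec u = z • u)
    (hs : s ^ 2 = -(r : ℂ) * z * (1 + γ * s)) :
    IsSolution γ r L (fun t i => (Complex.exp (s * t) * u i).re)
      (fun t i => (s * Complex.exp (s * t) * u i).re) := by
  have hexp : ∀ (w : ℂ) (t : ℝ),
      HasDerivAt (fun t : ℝ => (Complex.exp (s * t) * w).re) (s * Complex.exp (s * t) * w).re t := by
    intro w t
    have h : HasDerivAt (fun τ : ℂ => Complex.exp (s * τ) * w)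
        (s * Complex.exp (s * t) * w) (t : ℂ) := by
      have := (((hasDerivAt_id (t : ℂ)).const_mul s).cexp).mul_const w
      exact this.congr_deriv (by simp only [id_eq, mul_one]; ring)
    exact h.real_of_complex
  have hL : ∀ (w : ℂ) (i : V), L.mulVec (fun k => (w * u k).re) i = (w * z * u i).re := by
    intro w i
    rw [Matrix.mulVec_map_ofReal_re L (fun k => w * u k)]
    have : (fun k => w * u k) = w • u := rfl
    rw [this, Matrix.mulVec_smul, hu]
    simp [mul_assoc]
  intro t _
  constructor
  · exact (hasDerivAt_pi.2 fun i => hexp (u i) t).hasDerivWithinAt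
  · refine HasDerivAt.hasDerivWithinAt (hasDerivAt_pi.2 fun i => ?_)
    have h := hexp (s * u i) t
    have hfun : (fun τ : ℝ => (s * Complex.exp (s * τ) * u i).re)
        = fun τ : ℝ => (Complex.exp (s * τ) * (s * u i)).re := by
      funext τ; congr 1; ring
    rw [hfun]
    refine h.congr_deriv (Eq.symm ?_)
    · simp only [Pi.sub_apply, Pi.neg_apply, Pi.smul_apply, smul_eq_mul]
      rw [hL, hL, show s * Complex.exp (s * t) * (s * u i) = s ^ 2 * (Complex.exp (s * t) * u i) by
        ring, hs, ← Complex.re_ofReal_mul, ← Complex.re_ofReal_mul, ← Complex.neg_re,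
        ← Complex.sub_re]
      congr 1
      push_cast; ring

theorem ReachesConsensus.tendsto_re {V : Type*} [Fintype V] {γ r : ℝ} {L : Matrix V V ℝ}
    (h : ReachesConsensus γ r L) {u : V → ℂ} {z s : ℂ}
    (hu : (L.map ((↑) : ℝ → ℂ)).mulVec u = z • u)
    (hs : s ^ 2 = -(r : ℂ) * z * (1 + γ * s)) (i k : V) :
    Tendsto (fun t : ℝ => (Complex.exp (s * t) * (u i - u k)).re) atTop (𝓝 0) := by
  have h' := h _ _ (isSolution_re_exp γ r L u z s hu hs) i k
  refine squeeze_zero_norm (fun t => ?_) h'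
  have := EuclideanSpace.norm_eq (!₂[(Complex.exp (s * t) * u i).re - (Complex.exp (s * t) * u k).re,
    (s * Complex.exp (s * t) * u i).re - (s * Complex.exp (s * t) * u k).re])
  rw [this, Fin.sum_univ_two, mul_sub, Complex.sub_re]
  refine Real.le_sqrt_of_sq_le ?_
  simp only [Matrix.cons_val_zero, Matrix.cons_val_one]
  nlinarith [sq_nonneg ‖(s * Complex.exp (s * t) * u i).re - (s * Complex.exp (s * t) * u k).re‖]

theorem not_reachesConsensus_of_mem_spectrum {V : Type*} [Fintype V] [DecidableEq V] {γ r : ℝ}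
    (hγ : 0 < γ) (a : Matrix V V ℝ) {z : ℂ} (hz : z ∈ complexSpectrum (digraphLaplacian a))
    (hz0 : z ≠ 0) (hΩ : -(r : ℂ) * z ∉ consensusRegion (relativeVelocityVariable γ)) :
    ¬ ReachesConsensus γ r (digraphLaplacian a) := by
  intro hcons
  obtain ⟨u, hu0, hu⟩ := (mem_complexSpectrum_iff _ _).1 hz
  simp only [consensusRegion, Set.mem_ofPred_eq, not_forall, not_not] at hΩ
  obtain ⟨s, hs, hφ⟩ := hΩ
  have hden : (1 + (γ : ℂ) * s) ≠ 0 := by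
    intro h
    have := congrArg Complex.re h
    simp at this
    nlinarith [mul_nonneg hγ.le hs]
  have hs2 : s ^ 2 = -(r : ℂ) * z * (1 + γ * s) := by
    rw [relativeVelocityVariable, sub_eq_zero, div_eq_iff hden] at hφ
    exact hφ
  have hconst : ∀ i k, u i = u k := by
    intro i k
    have hre := hcons.tendsto_re hu hs2 i k
    -- The eigenvector `I • u` supplies the imaginary part of `exp (s t) (u i - u k)`. Both parts
    -- tend to zero, while `|exp (s t)| ≥ 1`.
    have huI : ((digraphLaplacian a).map ((↑) : ℝ → ℂ)).mulVec (Complex.I • u)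
        = z • (Complex.I • u) := by
      rw [Matrix.mulVec_smul, hu, smul_comm]
    have him := hcons.tendsto_re huI hs2 i k
    have hsq := (hre.pow 2).add (him.pow 2)
    have hle : ∀ᶠ t : ℝ in atTop, ‖u i - u k‖ ^ 2 ≤
        (Complex.exp (s * t) * (u i - u k)).re ^ 2 +
          (Complex.exp (s * t) * ((Complex.I • u) i - (Complex.I • u) k)).re ^ 2 := by
      filter_upwards [eventually_ge_atTop (0 : ℝ)] with t ht
      have h1 : (Complex.exp (s * t) * ((Complex.I • u) i - (Complex.I • u) k)).re
          = -(Complex.exp (s * t) * (u i - u k)).im := by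
        simp only [Pi.smul_apply, smul_eq_mul, ← mul_sub, mul_left_comm _ Complex.I,
          Complex.I_mul_re]
      have h2 : (1 : ℝ) ≤ ‖Complex.exp (s * t)‖ := by
        rw [Complex.norm_exp]
        simp only [Complex.mul_re, Complex.ofReal_re, Complex.ofReal_im, mul_zero, sub_zero]
        exact Real.one_le_exp (mul_nonneg hs ht)
      have h3 : (Complex.exp (s * t) * (u i - u k)).re ^ 2 +
          (-(Complex.exp (s * t) * (u i - u k)).im) ^ 2
          = ‖Complex.exp (s * t) * (u i - u k)‖ ^ 2 := by
        rw [Complex.sq_norm, Complex.normSq_apply]; ring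
      rw [h1, h3, norm_mul, mul_pow]
      have h4 : (1 : ℝ) ≤ ‖Complex.exp (s * t)‖ ^ 2 := one_le_pow₀ h2
      nlinarith [sq_nonneg ‖u i - u k‖]
    have h0 := ge_of_tendsto hsq hle
    have : ‖u i - u k‖ = 0 := by
      nlinarith [norm_nonneg (u i - u k)]
    exact sub_eq_zero.1 (norm_eq_zero.1 this)
  have := digraphLaplacian_map_mulVec_const a u hconst
  rw [hu] at this
  exact (smul_ne_zero hz0 hu0) this

/-! ### The consensus region -/

/-- Negative exactly on the consensus region, by `mem_consensusRegion_iff`. -/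
noncomputable def hurwitzForm (γ : ℝ) (z : ℂ) : ℝ :=
  z.im ^ 2 + γ ^ 2 * z.re * (z.re ^ 2 + z.im ^ 2)

/-- The roots `s, s'` of `s² - γ z s - z = 0` satisfy `s s' = -z`, so `s' = -s / (1 + γ s)` and `Re
s'` is a negative multiple of `Re s + γ |s|²`. Thus the form is `-Re s · Re s'` up to a nonnegative
factor. It follows from multiplying `z = s² / (1 + γ s)` by `|1 + γ s|²` and comparing real parts,
imaginary parts and moduli. -/
theorem hurwitzForm_of_sq_eq {γ : ℝ} {s z : ℂ} (h : s ^ 2 = z * (1 + γ * s)) :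
    hurwitzForm γ z * Complex.normSq (1 + γ * s) ^ 2 =
      s.re * (s.re + γ * Complex.normSq s) * (4 * s.im ^ 2 + γ ^ 2 * Complex.normSq s ^ 2) := by
  have hmul : z * (Complex.normSq (1 + γ * s) : ℂ) = s ^ 2 * (starRingEnd ℂ) (1 + γ * s) := by
    rw [h, Complex.normSq_eq_conj_mul_self]; ring
  have hre := congrArg Complex.re hmul
  have him := congrArg Complex.im hmul
  simp [pow_two] at hre him
  set D := Complex.normSq (1 + γ * s) with hD
  have hnz : (z.re ^ 2 + z.im ^ 2) * D = (s.re ^ 2 + s.im ^ 2) ^ 2 := by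
    have := congrArg Complex.normSq h
    rw [map_mul, map_pow, ← hD, Complex.normSq_apply, Complex.normSq_apply] at this
    linarith
  have h1 : hurwitzForm γ z * D ^ 2
      = (z.im * D) ^ 2 + γ ^ 2 * (z.re * D) * ((z.re ^ 2 + z.im ^ 2) * D) := by
    rw [hurwitzForm]; ring
  rw [h1, hre, him, hnz, Complex.normSq_apply]
  ring

theorem mem_consensusRegion_iff {γ : ℝ} (hγ : 0 < γ) (z : ℂ) :
    z ∈ consensusRegion (relativeVelocityVariable γ) ↔ hurwitzForm γ z < 0 := by
  constructor
  · intro h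
    obtain ⟨s, hs⟩ : ∃ s : ℂ, s ^ 2 = z * (1 + γ * s) := by
      -- Completing the square in `s² - γ z s - z = 0`.
      obtain ⟨s, hs⟩ := IsAlgClosed.exists_pow_nat_eq (z + (z * γ / 2) ^ 2) (n := 2) two_pos
      exact ⟨s + z * γ / 2, by linear_combination hs⟩
    have hz : z ≠ 0 := by
      rintro rfl
      exact h 0 le_rfl (by simp [relativeVelocityVariable])
    have hden : (1 + (γ : ℂ) * s) ≠ 0 := by
      intro h0
      rw [h0, mul_zero] at hs
      have : s = 0 := by simpa using hs
      simp [this] at h0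
    have hre : s.re < 0 := by
      by_contra! hc
      exact h s hc (by rw [relativeVelocityVariable, hs]; field_simp; ring)
    -- This is the second root of the same quadratic; it too must lie in the open left half-plane.
    have hre2 : (-s / (1 + γ * s)).re < 0 := by
      by_contra! hc
      refine h _ hc ?_
      have h1 : 1 + (γ : ℂ) * (-s / (1 + γ * s)) = 1 / (1 + γ * s) := by
        field_simp; ring
      rw [relativeVelocityVariable, h1, div_pow, neg_sq, hs]
      field_simp; ring
    have hD : 0 < Complex.normSq (1 + γ * s) := Complex.normSq_pos.2 hden
    have h2 : (-s / (1 + γ * s)).re * Complex.normSq (1 + γ * s)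
        = -(s.re + γ * Complex.normSq s) := by
      have h3 : -s / (1 + γ * s) * (Complex.normSq (1 + γ * s) : ℂ)
          = -(s + γ * (Complex.normSq s : ℂ)) := by
        rw [Complex.normSq_eq_conj_mul_self, Complex.normSq_eq_conj_mul_self]
        rw [div_mul_eq_mul_div, div_eq_iff hden]
        simp
        ring
      rw [← Complex.re_mul_ofReal, h3]
      simp
    have h3 : 0 < s.re + γ * Complex.normSq s := by
      nlinarith [mul_pos_of_neg_of_neg hre2 (neg_lt_zero.2 hD)]
    have hs0 : 0 < Complex.normSq s := Complex.normSq_pos.2 (by rintro rfl; simp at hre)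
    have h4 := hurwitzForm_of_sq_eq hs
    have h5 : 0 < (4 * s.im ^ 2 + γ ^ 2 * Complex.normSq s ^ 2) := by positivity
    have h6 := mul_neg_of_neg_of_pos (mul_neg_of_neg_of_pos hre h3) h5
    rw [← h4] at h6
    by_contra! hc
    exact absurd h6 (not_lt.2 (by positivity))
  · intro h s hs hφ
    have hden : (1 + (γ : ℂ) * s) ≠ 0 := by
      intro h
      have := congrArg Complex.re h
      simp at this
      nlinarith [mul_nonneg hγ.le hs]
    rw [relativeVelocityVariable, sub_eq_zero, div_eq_iff hden] at hφ
    have h4 := hurwitzForm_of_sq_eq hφ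
    have hD : 0 < Complex.normSq (1 + γ * s) := Complex.normSq_pos.2 hden
    have := Complex.normSq_nonneg s
    have h5 : 0 ≤ s.re * (s.re + γ * Complex.normSq s) *
      (4 * s.im ^ 2 + γ ^ 2 * Complex.normSq s ^ 2) := by positivity
    rw [← h4] at h5
    exact absurd h5 (not_le.2 (mul_neg_of_neg_of_pos h (by positivity)))

theorem continuous_hurwitzForm (γ : ℝ) : Continuous (hurwitzForm γ) := by
  unfold hurwitzForm
  fun_prop

theorem mem_boundaryCurve_iff {γ : ℝ} (hγ : 0 < γ) (z : ℂ) :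
    z ∈ boundaryCurve γ ↔ hurwitzForm γ z = 0 := by
  simp only [boundaryCurve, Set.mem_ofPred_eq, hurwitzForm]
  constructor
  · rintro ⟨h1, h2⟩
    rw [eq_div_iff h1] at h2
    linarith
  · intro h
    have h1 : γ ^ 2 * z.re + 1 ≠ 0 := by
      intro h1
      have h2 : γ ^ 2 * z.re ^ 3 = 0 := by linear_combination h - z.im ^ 2 * h1
      have h3 : z.re = 0 := by simpa [hγ.ne'] using h2
      simp [h3] at h1
    exact ⟨h1, by rw [eq_div_iff h1]; linarith⟩

theorem frontier_consensusRegion {γ : ℝ} (hγ : 0 < γ) :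
    frontier (consensusRegion (relativeVelocityVariable γ)) = boundaryCurve γ := by
  have hset : consensusRegion (relativeVelocityVariable γ) = {z | hurwitzForm γ z < 0} := by
    ext z; exact mem_consensusRegion_iff hγ z
  ext z
  rw [mem_boundaryCurve_iff hγ, hset]
  constructor
  · intro hz
    exact frontier_lt_subset_eq (continuous_hurwitzForm γ) continuous_const hz
  · intro hz
    have hopen : IsOpen {z | hurwitzForm γ z < 0} :=
      isOpen_lt (continuous_hurwitzForm γ) continuous_const
    rw [hopen.frontier_eq]
    refine ⟨?_, by simp [hz]⟩
    by_cases hz0 : z = 0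
    · subst hz0
      -- The origin is approached along the negative real axis, the axis of the cusp.
      have ht : Tendsto (fun t : ℝ => ((-t : ℝ) : ℂ)) (𝓝[>] 0) (𝓝 0) := by
        have : Continuous fun t : ℝ => ((-t : ℝ) : ℂ) := by fun_prop
        simpa using (this.tendsto 0).mono_left nhdsWithin_le_nhds
      refine mem_closure_of_tendsto ht ?_
      filter_upwards [self_mem_nhdsWithin] with t (ht : 0 < t)
      have : 0 < γ ^ 2 * t * t ^ 2 := by positivity
      simp [hurwitzForm]
      linarith
    -- The form is `y²` plus a homogeneous cubic. On its zero set, scaling outwards makes the cubic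
    -- part, which equals `-y²` there, outgrow the quadratic one.
    · have ht : Tendsto (fun t : ℝ => ((1 + t : ℝ) : ℂ) * z) (𝓝[>] 0) (𝓝 z) := by
        have : Continuous fun t : ℝ => ((1 + t : ℝ) : ℂ) * z := by fun_prop
        simpa using (this.tendsto 0).mono_left nhdsWithin_le_nhds
      refine mem_closure_of_tendsto ht ?_
      filter_upwards [self_mem_nhdsWithin] with t (ht : 0 < t)
      have him : 0 < z.im ^ 2 := by
        rw [hurwitzForm] at hz
        by_contra! hc
        have h0 : z.im = 0 := by nlinarith [sq_nonneg z.im]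
        rw [h0] at hz
        have h3 : γ ^ 2 * z.re ^ 3 = 0 := by linear_combination hz
        have h3 : z.re = 0 := by simpa [hγ.ne'] using h3
        exact hz0 (Complex.ext h3 h0)
      have : hurwitzForm γ (((1 + t : ℝ) : ℂ) * z) = -((1 + t) ^ 2 * t * z.im ^ 2) := by
        have e : hurwitzForm γ (((1 + t : ℝ) : ℂ) * z)
            = (1 + t) ^ 3 * hurwitzForm γ z - (1 + t) ^ 2 * t * z.im ^ 2 := by
          simp only [hurwitzForm, Complex.re_ofReal_mul, Complex.im_ofReal_mul]
          ring
        rw [e, hz]; ring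
      simp only [this, neg_lt_zero]
      positivity

/-- Eigenvalues approaching the origin tangentially to the imaginary axis leave the consensus
region. -/
theorem eventually_notMem_consensusRegion {γ r b : ℝ} (hγ : 0 < γ) (hr : 0 < r) (hb : b ≠ 0)
    {θ : ℕ → ℝ} (hθ : ∀ᶠ m in atTop, 0 < θ m) (hθ0 : Tendsto θ atTop (𝓝 0)) {z : ℕ → ℂ}
    (hz : Tendsto (fun m => z m / θ m) atTop (𝓝 (b * Complex.I))) :
    ∀ᶠ m in atTop, z m ≠ 0 ∧ -(r : ℂ) * z m ∉ consensusRegion (relativeVelocityVariable γ) := by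
  have hre : Tendsto (fun m => (z m / θ m).re) atTop (𝓝 0) := by
    simpa [Function.comp_def] using (Complex.continuous_re.tendsto _).comp hz
  have him : Tendsto (fun m => (z m / θ m).im) atTop (𝓝 b) := by
    simpa [Function.comp_def] using (Complex.continuous_im.tendsto _).comp hz
  -- This is the form at `-r z` divided by `r² θ²`: the cubic part keeps a factor `θ` and disappears
  -- in the limit.
  have hlim : Tendsto (fun m => (z m / θ m).im ^ 2 - γ ^ 2 * r * θ m * (z m / θ m).re *
      ((z m / θ m).re ^ 2 + (z m / θ m).im ^ 2)) atTop (𝓝 (b ^ 2)) := by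
    have := (him.pow 2).sub
      (((hθ0.const_mul (γ ^ 2 * r)).mul hre).mul ((hre.pow 2).add (him.pow 2)))
    simpa using this
  have hpos := hlim.eventually (lt_mem_nhds (by positivity : 0 < b ^ 2))
  filter_upwards [hpos, hθ] with m hm hθm
  have hform : 0 < hurwitzForm γ (-(r : ℂ) * z m) := by
    have e : hurwitzForm γ (-(r : ℂ) * z m) = r ^ 2 * θ m ^ 2 * ((z m / θ m).im ^ 2 -
        γ ^ 2 * r * θ m * (z m / θ m).re * ((z m / θ m).re ^ 2 + (z m / θ m).im ^ 2)) := by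
      have h1 : (z m / θ m).re = (z m).re / θ m := Complex.div_ofReal_re _ _
      have h2 : (z m / θ m).im = (z m).im / θ m := Complex.div_ofReal_im _ _
      rw [h1, h2]
      simp only [hurwitzForm, ← Complex.ofReal_neg, Complex.re_ofReal_mul, Complex.im_ofReal_mul]
      field_simp
      ring
    rw [e]
    positivity
  refine ⟨?_, fun h => ?_⟩
  · intro h0
    simp [h0, hurwitzForm] at hform
  · exact absurd ((mem_consensusRegion_iff hγ _).1 h) (not_lt.2 hform.le)

/-! ### Ring digraphs -/

theorem val_eq_succ_mod_iff {m : ℕ} (i q : Fin m) :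
    i.val = (q.val + 1) % m ↔ i = finRotate m q := by
  have : NeZero m := ⟨by have := q.isLt; omega⟩
  rw [finRotate_apply, Fin.ext_iff, Fin.val_add, Fin.val_one', Nat.add_mod_mod]

theorem ringLaplacian_map_mulVec (m n : ℕ) (S : Finset ℕ) (u : Fin m × Fin n → ℂ)
    (i : Fin m) (j : Fin n) :
    ((ringLaplacian m n S).map ((↑) : ℝ → ℂ)).mulVec u (i, j) =
      (if 0 < j.val then u (i, j) - u (i, ⟨j - 1, by omega⟩) else 0) +
      (if h : j.val ∈ S ∧ j.val + 1 < n then u (i, j) - u (i, ⟨j + 1, h.2⟩) else 0) +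
      (if j.val = 0 then u (i, j) - u ((finRotate m).symm i, ⟨n - 1, by have := j.isLt; omega⟩) else 0) := by
  rw [ringLaplacian, digraphLaplacian_map_mulVec]
  simp only [ringAdjacency, Matrix.of_apply, Complex.ofReal_add, add_mul, Finset.sum_add_distrib]
  congr 1
  · congr 1
    · split_ifs with h
      · rw [Finset.sum_eq_single (i, ⟨j - 1, by omega⟩)]
        · rw [if_pos ⟨rfl, by simp only; omega⟩]; simp
        · rintro ⟨i', j'⟩ - hne
          rw [if_neg]
          · simp
          · rintro ⟨h1, h2⟩
            exact hne (Prod.ext h1.symm (Fin.ext (by simp only at h2 ⊢; omega)))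
        · simp
      · refine Finset.sum_eq_zero fun q _ => ?_
        rw [if_neg (by rintro ⟨-, h2⟩; change j.val = _ at h2; omega)]; simp
    · split_ifs with h
      · rw [Finset.sum_eq_single (i, ⟨j + 1, h.2⟩)]
        · rw [if_pos ⟨rfl, h.1, rfl⟩]; simp
        · rintro ⟨i', j'⟩ - hne
          rw [if_neg]
          · simp
          · rintro ⟨h1, h2, h3⟩
            exact hne (Prod.ext h1.symm (Fin.ext h3))
        · simp
      · refine Finset.sum_eq_zero fun q _ => ?_
        rw [if_neg]
        · simp
        · rintro ⟨-, h2, h3⟩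
          exact h ⟨h2, by have := q.2.isLt; change q.2.val = j.val + 1 at h3; omega⟩
  · split_ifs with h
    · rw [Finset.sum_eq_single ((finRotate m).symm i, ⟨n - 1, by omega⟩)]
      · rw [if_pos ⟨(val_eq_succ_mod_iff _ _).2 (Equiv.apply_symm_apply _ _).symm, h, by have := j.isLt; simp only; omega⟩]
        simp
      · rintro ⟨i', j'⟩ - hne
        rw [if_neg]
        · simp
        · rintro ⟨h1, h2, h3⟩
          refine hne (Prod.ext ?_ (Fin.ext (by simp only at h3 ⊢; omega)))
          exact (Equiv.eq_symm_apply _).2 ((val_eq_succ_mod_iff _ _).1 h1).symm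
      · simp
    · refine Finset.sum_eq_zero fun q _ => ?_
      rw [if_neg (fun h' => h h'.2.1)]; simp

/-- Solves the eigenvalue equations of a macro-vertex from its last node to its first: the pair
of the value at the `t`-th node from the end and its increment over the preceding node. -/
noncomputable def macroTransfer (n : ℕ) (S : Finset ℕ) (z : ℂ) : ℕ → ℂ × ℂ
  | 0 => (1, 0)
  | t + 1 =>
    let d := (if n - 1 - t ∈ S then (macroTransfer n S z t).2 else 0)
      - z * (macroTransfer n S z t).1
    ((macroTransfer n S z t).1 + d, d)

theorem macroTransfer_fst_succ (n : ℕ) (S : Finset ℕ) (z : ℂ) (t : ℕ) :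
    (macroTransfer n S z (t + 1)).1 = (macroTransfer n S z t).1 + (macroTransfer n S z (t + 1)).2 :=
  rfl

theorem macroTransfer_snd_succ (n : ℕ) (S : Finset ℕ) (z : ℂ) (t : ℕ) :
    (macroTransfer n S z (t + 1)).2 = (if n - 1 - t ∈ S then (macroTransfer n S z t).2 else 0)
      - z * (macroTransfer n S z t).1 :=
  rfl

theorem macroTransfer_zero_fst (n : ℕ) (S : Finset ℕ) (t : ℕ) :
    (macroTransfer n S 0 t).1 = 1 ∧ (macroTransfer n S 0 t).2 = 0 := by
  induction t with
  | zero => exact ⟨rfl, rfl⟩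
  | succ t ih =>
    have h : (macroTransfer n S 0 (t + 1)).2 = 0 := by simp [macroTransfer_snd_succ, ih.2]
    exact ⟨by rw [macroTransfer_fst_succ, h, ih.1, add_zero], h⟩

/-- At `z = 0` the pair is `(1, 0)`, so the derivatives obey `β' = β - 1` or `β' = -1`, and `α' = α
+ β'`. They are real and cannot cancel. Nonvanishing permits local inversion, and reality makes the
resulting eigenvalues approach `0` along the imaginary axis. -/
theorem macroTransfer_hasStrictDerivAt (n : ℕ) (S : Finset ℕ) (t : ℕ) :
    ∃ α β : ℝ, HasStrictDerivAt (fun z => (macroTransfer n S z t).1) (α : ℂ) 0 ∧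
      HasStrictDerivAt (fun z => (macroTransfer n S z t).2) (β : ℂ) 0 ∧
      β ≤ 0 ∧ α ≤ 0 ∧ (0 < t → α < 0) := by
  induction t with
  | zero =>
    exact ⟨0, 0, (hasStrictDerivAt_const (0 : ℂ) (1 : ℂ)).congr_deriv (by simp),
      (hasStrictDerivAt_const (0 : ℂ) (0 : ℂ)).congr_deriv (by simp), le_rfl, le_rfl, by simp⟩
  | succ t ih =>
    obtain ⟨α, β, hα, hβ, hβ0, hα0, -⟩ := ih
    have hmul : HasStrictDerivAt (fun z => z * (macroTransfer n S z t).1) 1 0 := by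
      refine ((hasStrictDerivAt_id (0 : ℂ)).mul hα).congr_deriv ?_
      simp [(macroTransfer_zero_fst n S t).1]
    have hd : ∃ β' : ℝ, β' ≤ -1 ∧
        HasStrictDerivAt (fun z => (macroTransfer n S z (t + 1)).2) (β' : ℂ) 0 := by
      simp only [macroTransfer_snd_succ]
      split_ifs with h
      · exact ⟨β - 1, by linarith, (hβ.sub hmul).congr_deriv (by simp)⟩
      · exact ⟨-1, le_rfl, ((hasStrictDerivAt_const (0 : ℂ) (0 : ℂ)).sub hmul).congr_deriv (by simp)⟩
    obtain ⟨β', hβ', hd⟩ := hd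
    refine ⟨α + β', β', ?_, hd, by linarith, by linarith, fun _ => by linarith⟩
    exact (hα.add hd).congr_deriv (by simp)

/-- A Bloch wave: the macro-vertex profile from `macroTransfer` is repeated with factor `ω⁻¹` per
macro-vertex, and `ω ^ m = 1` closes it around the ring. It is nonzero because the last node of the
first macro-vertex has value `1`. -/
theorem mem_complexSpectrum_ringLaplacian {m n : ℕ} (hm : 1 ≤ m) (hn : 1 ≤ n) (S : Finset ℕ)
    {z : ℂ} (hz : (macroTransfer n S z n).1 ^ m = 1) :
    z ∈ complexSpectrum (ringLaplacian m n S) := by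
  set ω := (macroTransfer n S z n).1 with hω
  have hω0 : ω ≠ 0 := by
    intro h
    rw [h, zero_pow (by omega)] at hz
    exact zero_ne_one hz
  have hrot : ∀ i : Fin m, ω⁻¹ ^ ((finRotate m).symm i).val = ω * ω⁻¹ ^ i.val := by
    intro i
    obtain ⟨q, rfl⟩ := (finRotate m).surjective i
    rw [Equiv.symm_apply_apply, (val_eq_succ_mod_iff (finRotate m q) q).2 rfl,
      ← pow_eq_pow_mod _ (by rw [inv_pow, hz, inv_one]), pow_succ]
    field_simp
  rw [mem_complexSpectrum_iff]
  refine ⟨fun p => ω⁻¹ ^ p.1.val * (macroTransfer n S z (n - 1 - p.2.val)).1, ?_, ?_⟩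
  · intro h
    have := congrFun h (⟨0, hm⟩, ⟨n - 1, by omega⟩)
    simp [macroTransfer] at this
  · funext ⟨i, j⟩
    rw [ringLaplacian_map_mulVec]
    simp only [Pi.smul_apply, smul_eq_mul, hrot]
    obtain ⟨t, ht⟩ : ∃ t, t = n - 1 - j.val := ⟨_, rfl⟩
    have hj := j.isLt
    have e1 : n - 1 - (n - 1) = 0 := by omega
    have hd := macroTransfer_snd_succ n S z t
    have hq := macroTransfer_fst_succ n S z t
    have hjt : n - 1 - t = j.val := by omega
    rw [hjt] at hd
    have hfwd : (if j.val ∈ S ∧ j.val + 1 < n then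
        ω⁻¹ ^ i.val * (macroTransfer n S z (n - 1 - j.val)).1
          - ω⁻¹ ^ i.val * (macroTransfer n S z (n - 1 - (j.val + 1))).1 else 0)
        = ω⁻¹ ^ i.val * (if j.val ∈ S then (macroTransfer n S z t).2 else 0) := by
      rw [← ht]
      by_cases hS : j.val ∈ S
      · by_cases hlt : j.val + 1 < n
        · obtain ⟨k, rfl⟩ : ∃ k, t = k + 1 := ⟨t - 1, by omega⟩
          rw [if_pos ⟨hS, hlt⟩, if_pos hS, show n - 1 - (j.val + 1) = k by omega,
            macroTransfer_fst_succ]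
          ring
        -- The last node has no reverse arc even if its index lies in `S`; the initial increment `0`
        -- of `macroTransfer` accounts for this.
        · have : t = 0 := by omega
          rw [if_neg (by tauto), if_pos hS, this]
          simp [macroTransfer]
      · rw [if_neg (by tauto), if_neg hS, mul_zero]
    simp only [dite_eq_ite]
    rw [hfwd, ← ht, e1]
    rcases Nat.eq_zero_or_pos j.val with h0 | h0
    · have hn' : t + 1 = n := by omega
      rw [hn', ← hω] at hq
      rw [hn'] at hd
      rw [if_neg (by omega), if_pos h0]
      simp only [macroTransfer]
      rw [hq, hd]
      ring
    · rw [if_pos h0, if_neg h0.ne', show n - 1 - (j.val - 1) = t + 1 by omega, hq, hd]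
      ring

/-! ### Eigenvalues of long rings near the origin -/

theorem tendsto_angle_zero : Tendsto (fun m : ℕ => 2 * Real.pi / (m : ℝ)) atTop (𝓝 0) :=
  tendsto_const_div_atTop_nhds_zero_nat _

theorem eventually_angle_pos : ∀ᶠ m : ℕ in atTop, 0 < 2 * Real.pi / (m : ℝ) := by
  filter_upwards [eventually_gt_atTop 0] with m hm
  have := Real.pi_pos
  positivity

theorem exp_angle_pow_eq_one {m : ℕ} (hm : 1 ≤ m) :
    Complex.exp ((2 * Real.pi / m : ℝ) * Complex.I) ^ m = 1 := by
  rw [← Complex.exp_nat_mul, Complex.exp_eq_one_iff]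
  refine ⟨1, ?_⟩
  have : (m : ℂ) ≠ 0 := by exact_mod_cast (by omega : m ≠ 0)
  push_cast
  field_simp

theorem tendsto_exp_sub_one_div :
    Tendsto (fun m : ℕ => (Complex.exp ((2 * Real.pi / m : ℝ) * Complex.I) - 1)
      / ((2 * Real.pi / m : ℝ) : ℂ)) atTop (𝓝 Complex.I) := by
  have h : HasDerivAt (fun x : ℝ => Complex.exp (x * Complex.I)) Complex.I 0 := by
    have := ((hasDerivAt_id (0 : ℝ)).ofReal_comp.mul_const Complex.I).cexp
    simpa using this
  have ht := (hasDerivAt_iff_tendsto_slope_zero.1 h).comp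
    (tendsto_nhdsWithin_iff.2 ⟨tendsto_angle_zero, eventually_angle_pos.mono fun _ h => h.ne'⟩)
  refine ht.congr fun m => ?_
  simp [div_eq_inv_mul]

theorem eventually_not_reachesConsensus_ringLaplacian {γ r : ℝ} (hγ : 0 < γ) (hr : 0 < r) {n : ℕ}
    (hn : 1 ≤ n) (S : Finset ℕ) :
    ∀ᶠ m : ℕ in atTop, ¬ ReachesConsensus γ r (ringLaplacian m n S) := by
  obtain ⟨α, -, hα, -, -, -, hα0⟩ := macroTransfer_hasStrictDerivAt n S n
  have hα0 : (α : ℂ) ≠ 0 := by exact_mod_cast (hα0 (by omega)).ne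
  -- The local inverse of the transfer polynomial turns each root of unity near `1` into an
  -- eigenvalue near `0`.
  set g := hα.localInverse _ _ _ hα0 with hg
  have hf0 : (macroTransfer n S 0 n).1 = 1 := (macroTransfer_zero_fst n S n).1
  have hg1 : g 1 = 0 := by
    have := (hα.eventually_left_inverse hα0).self_of_nhds
    rwa [hf0] at this
  have hgd : HasDerivAt g (α : ℂ)⁻¹ 1 := by
    have := (hα.to_localInverse hα0).hasDerivAt
    rwa [hf0] at this
  have hginv : ∀ᶠ w in 𝓝 (1 : ℂ), (macroTransfer n S (g w) n).1 = w := by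
    have := hα.eventually_right_inverse hα0
    rwa [hf0] at this
  set ω : ℕ → ℂ := fun m => Complex.exp ((2 * Real.pi / m : ℝ) * Complex.I) with hω
  have hωc : Tendsto ω atTop (𝓝 1) := by
    have hc : Continuous fun x : ℝ => Complex.exp (x * Complex.I) := by fun_prop
    simpa [Function.comp_def, hω] using (hc.tendsto 0).comp tendsto_angle_zero
  have hω1 : ∀ᶠ m in atTop, ω m ≠ 1 := by
    have := tendsto_exp_sub_one_div.eventually_ne Complex.I_ne_zero
    filter_upwards [this] with m hm (h1 : Complex.exp _ = 1)
    exact hm (by rw [h1, sub_self, zero_div])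
  have hlim : Tendsto (fun m => g (ω m) / ((2 * Real.pi / m : ℝ) : ℂ)) atTop
      (𝓝 ((α⁻¹ : ℝ) * Complex.I)) := by
    have h1 := (hasDerivAt_iff_tendsto_slope.1 hgd).comp
      (tendsto_nhdsWithin_iff.2 ⟨hωc, hω1⟩)
    have h2 := h1.mul tendsto_exp_sub_one_div
    rw [Complex.ofReal_inv]
    refine h2.congr' ?_
    filter_upwards [hω1] with m hm
    have : ω m - 1 ≠ 0 := sub_ne_zero.2 hm
    change slope g 1 (ω m) * ((ω m - 1) / _) = _
    rw [slope_def_field, hg1, sub_zero, div_mul_div_cancel₀ this]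
  have hα' : (α⁻¹ : ℝ) ≠ 0 := inv_ne_zero (by exact_mod_cast hα0)
  filter_upwards [eventually_notMem_consensusRegion hγ hr hα' eventually_angle_pos
    tendsto_angle_zero hlim, hωc.eventually hginv, eventually_ge_atTop 1] with m hm hgm h1
  refine not_reachesConsensus_of_mem_spectrum hγ _ ?_ hm.1 hm.2
  refine mem_complexSpectrum_ringLaplacian h1 hn S ?_
  rw [hgm]
  exact exp_angle_pow_eq_one h1

/-! ### The drop-shaped region -/

theorem dropFun_nonneg {x : ℝ} (hx : x ≤ 4) : 0 ≤ dropFun x := by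
  unfold dropFun
  split_ifs with h
  · positivity
  · push Not at h
    have h3 : √(1 + 2 * x) ≤ 3 := by
      rw [Real.sqrt_le_left (by norm_num)]; linarith
    have : 0 ≤ 3 - √(1 + 2 * x) := by linarith
    positivity

theorem dropFun_sq_of_le {x : ℝ} (hx0 : 0 ≤ x) (hx : x ≤ 3 / 2) :
    dropFun x ^ 2 = 2 * x - x ^ 2 := by
  rw [dropFun, if_pos hx, Real.sq_sqrt (by nlinarith)]
  ring

/-- The parameter `q = √(1 + 2x)` rationalizes the curve: `q - x + 1 = (3 - q)(1 + q) / 2`. -/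
theorem dropFun_sq_of_lt {x q : ℝ} (hx : 3 / 2 < x) (hq : 0 ≤ q) (hq3 : q ≤ 3)
    (hxq : x = (q ^ 2 - 1) / 2) :
    dropFun x ^ 2 = (1 + q) * (3 - q) ^ 3 / 4 := by
  have hs : √(1 + 2 * x) = q := by
    rw [hxq, show 1 + 2 * ((q ^ 2 - 1) / 2) = q ^ 2 by ring, Real.sqrt_sq hq]
  rw [dropFun, if_neg (not_le.2 hx), hs, mul_pow, mul_pow, div_pow, Real.sq_sqrt (by norm_num),
    Real.sq_sqrt (by rw [hxq]; nlinarith), hxq]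
  ring

/-- For fixed `c` these points fill an ellipse. Left of `3/2` the ellipses are bounded by the unit
circle, which is the case `c = 0`; to the right they are bounded by their envelope. -/
theorem abs_le_dropFun {x y c p : ℝ} (hc0 : 0 ≤ c) (hc1 : c ≤ 1) (hp : p ^ 2 ≤ 1)
    (hx : x = (1 + c) * (1 - p)) (hy : y ^ 2 ≤ (1 - c) ^ 2 * (1 - p ^ 2)) :
    0 ≤ x ∧ x ≤ 4 ∧ |y| ≤ dropFun x := by
  obtain ⟨hp1, hp2⟩ := abs_le.1 ((sq_le_one_iff_abs_le_one p).1 hp)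
  have hx0 : 0 ≤ x := by rw [hx]; nlinarith
  have hx4 : x ≤ 4 := by rw [hx]; nlinarith
  refine ⟨hx0, hx4, abs_le_of_sq_le_sq ?_ (dropFun_nonneg hx4)⟩
  rcases le_or_gt x (3 / 2) with h | h
  · rw [dropFun_sq_of_le hx0 h]
    refine hy.trans ?_
    have hcp : c ≤ 1 + 2 * p := by
      rw [hx] at h
      nlinarith
    have e : 2 * x - x ^ 2 - (1 - c) ^ 2 * (1 - p ^ 2) = 2 * c * (1 - p) * (1 + 2 * p - c) := by
      rw [hx]; ring
    nlinarith [mul_nonneg (mul_nonneg hc0 (by linarith : 0 ≤ 1 - p)) (by linarith : 0 ≤ 1 + 2 * p - c)]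
  · obtain ⟨q, hq0, hxq⟩ : ∃ q : ℝ, 0 ≤ q ∧ x = (q ^ 2 - 1) / 2 :=
      ⟨√(1 + 2 * x), Real.sqrt_nonneg _, by rw [Real.sq_sqrt (by linarith)]; ring⟩
    have hq3 : q ≤ 3 := by nlinarith
    have hq1 : 1 ≤ q := by nlinarith
    rw [dropFun_sq_of_lt h hq0 hq3 hxq]
    refine hy.trans ?_
    have ht : 0 < 1 - p := by
      rcases hp2.lt_or_eq with h' | h'
      · linarith
      · rw [h', sub_self, mul_zero] at hx; linarith
    have hct : c * (1 - p) = x - (1 - p) := by rw [hx]; ring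
    have hk : 0 ≤ (1 - p) - (q - 1) ^ 2 / 2 := by nlinarith
    -- The double root `1 - p = (1 + q) / 2` is the tangency of an ellipse with the envelope. The
    -- other factor is nonnegative because `c ≤ 1` gives `x ≤ 2 (1 - p)`, and `1 ≤ q ≤ 3`.
    have e : (1 - p) * ((1 + q) * (3 - q) ^ 3 / 4 - (1 - c) ^ 2 * (1 - p ^ 2))
        = 4 * ((1 - p) - (1 + q) / 2) ^ 2 * ((1 - p) - (q - 1) ^ 2 / 2) := by
      have e2 : (1 - p) * ((1 - c) ^ 2 * (1 - p ^ 2))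
          = (2 * (1 - p) - x) ^ 2 * (2 - (1 - p)) := by
        linear_combination (-(1 + p)) * ((1 - c) * (1 - p) + (2 * (1 - p) - x)) * hct
      rw [mul_sub, e2, hxq]; ring
    have h0 : 0 ≤ (1 - p) * ((1 + q) * (3 - q) ^ 3 / 4 - (1 - c) ^ 2 * (1 - p ^ 2)) := by
      rw [e]; positivity
    exact sub_nonneg.1 (nonneg_of_mul_nonneg_right h0 ht)

/-! ### Spectra on the algebraic curves -/

/-- A permutation preserves `∑ ‖w i‖`. Applied to the last-node values of an eigenvector, which
determine all the others, it yields `‖P(z)‖ = 1`, the equation of the curve. -/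
theorem norm_eq_one_of_apply_equiv_eq_mul {ι : Type*} [Fintype ι] (e : ι ≃ ι) {w : ι → ℂ}
    (hw : w ≠ 0) {P : ℂ} (h : ∀ i, w (e i) = P * w i) : ‖P‖ = 1 := by
  have hsum : ∑ i, ‖w i‖ = ‖P‖ * ∑ i, ‖w i‖ := by
    rw [Finset.mul_sum, ← Equiv.sum_comp e]
    exact Finset.sum_congr rfl fun i _ => by rw [h, norm_mul]
  obtain ⟨i, hi⟩ := Function.ne_iff.1 hw
  have hpos : 0 < ∑ i, ‖w i‖ :=
    Finset.sum_pos' (fun i _ => norm_nonneg _) ⟨i, Finset.mem_univ i, norm_pos_iff.2 hi⟩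
  exact (mul_right_cancel₀ hpos.ne' (by linarith)).symm

theorem Complex.re_sq_add_im_sq_of_norm_eq_one {w : ℂ} (h : ‖w‖ = 1) : w.re ^ 2 + w.im ^ 2 = 1 := by
  have := Complex.sq_norm w
  rw [h, Complex.normSq_apply] at this
  linarith

theorem complexSpectrum_ring_one_subset (m : ℕ) :
    complexSpectrum (ringLaplacian m 1 ∅) ⊆ unitCircleAtOne := by
  intro z hz
  obtain ⟨u, hu0, hu⟩ := (mem_complexSpectrum_iff _ _).1 hz
  have h0 : ∀ i, _ := fun i => congrFun hu (i, (0 : Fin 1))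
  simp only [ringLaplacian_map_mulVec] at h0
  simp [-finRotate_apply, -finRotate_symm_apply] at h0
  have hP := norm_eq_one_of_apply_equiv_eq_mul (finRotate m).symm (w := fun i => u (i, 0))
    (P := 1 - z) (fun h => hu0 ?_) (fun i => by linear_combination -h0 i)
  · have := Complex.re_sq_add_im_sq_of_norm_eq_one hP
    simp at this
    simp only [unitCircleAtOne, Set.mem_ofPred_eq]
    linarith
  · funext ⟨i, j⟩
    fin_cases j
    exact congrFun h i

theorem complexSpectrum_ring_two_subset (m : ℕ) :
    complexSpectrum (ringLaplacian m 2 {0}) ⊆ cassiniOvals := by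
  intro z hz
  obtain ⟨u, hu0, hu⟩ := (mem_complexSpectrum_iff _ _).1 hz
  have h0 : ∀ i, _ := fun i => congrFun hu (i, (0 : Fin 2))
  have h1 : ∀ i, _ := fun i => congrFun hu (i, (1 : Fin 2))
  simp only [ringLaplacian_map_mulVec] at h0 h1
  simp [-finRotate_apply, -finRotate_symm_apply] at h0 h1
  have e0 : ∀ i, u (i, 0) = (1 - z) * u (i, 1) := fun i => by linear_combination -h1 i
  have hP := norm_eq_one_of_apply_equiv_eq_mul (finRotate m).symm (w := fun i => u (i, 1))
    (P := (2 - z) * (1 - z) - 1) (fun h => hu0 ?_)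
    (fun i => by linear_combination -h0 i + (2 - z) * e0 i)
  · have := Complex.re_sq_add_im_sq_of_norm_eq_one hP
    simp at this
    simp only [cassiniOvals, Set.mem_ofPred_eq]
    have h5 : √5 ^ 2 = (5 : ℝ) := Real.sq_sqrt (by norm_num)
    linear_combination 16 * this + ((√5 ^ 2 + 5) - 2 * ((2 * (z.re - 3 / 2)) ^ 2 - (2 * z.im) ^ 2)) * h5
  · funext ⟨i, j⟩
    have h1' : u (i, 1) = 0 := congrFun h i
    fin_cases j
    · simpa [h1'] using e0 i
    · exact h1'

theorem complexSpectrum_ring_three_one_subset (m : ℕ) :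
    complexSpectrum (ringLaplacian m 3 {0}) ⊆ sexticOne := by
  intro z hz
  obtain ⟨u, hu0, hu⟩ := (mem_complexSpectrum_iff _ _).1 hz
  have h0 : ∀ i, _ := fun i => congrFun hu (i, (0 : Fin 3))
  have h1 : ∀ i, _ := fun i => congrFun hu (i, (1 : Fin 3))
  have h2 : ∀ i, _ := fun i => congrFun hu (i, (2 : Fin 3))
  simp only [ringLaplacian_map_mulVec] at h0 h1 h2
  simp [-finRotate_apply, -finRotate_symm_apply] at h0 h1 h2
  have e1 : ∀ i, u (i, 1) = (1 - z) * u (i, 2) := fun i => by linear_combination -h2 i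
  have e0 : ∀ i, u (i, 0) = (1 - z) ^ 2 * u (i, 2) := fun i => by
    linear_combination -h1 i + (1 - z) * e1 i
  have hP := norm_eq_one_of_apply_equiv_eq_mul (finRotate m).symm (w := fun i => u (i, 2))
    (P := (2 - z) * (1 - z) ^ 2 - (1 - z)) (fun h => hu0 ?_)
    (fun i => by linear_combination -h0 i + (2 - z) * e0 i - e1 i)
  · have := Complex.re_sq_add_im_sq_of_norm_eq_one hP
    simp [pow_two] at this
    simp only [sexticOne, sexticOnePoly, Set.mem_ofPred_eq]
    linear_combination this
  · funext ⟨i, j⟩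
    have h2' : u (i, 2) = 0 := congrFun h i
    fin_cases j
    · simpa [h2'] using e0 i
    · simpa [h2'] using e1 i
    · exact h2'

theorem complexSpectrum_ring_three_two_subset (m : ℕ) :
    complexSpectrum (ringLaplacian m 3 {0, 1}) ⊆ sexticTwo := by
  intro z hz
  obtain ⟨u, hu0, hu⟩ := (mem_complexSpectrum_iff _ _).1 hz
  have h0 : ∀ i, _ := fun i => congrFun hu (i, (0 : Fin 3))
  have h1 : ∀ i, _ := fun i => congrFun hu (i, (1 : Fin 3))
  have h2 : ∀ i, _ := fun i => congrFun hu (i, (2 : Fin 3))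
  simp only [ringLaplacian_map_mulVec] at h0 h1 h2
  simp [-finRotate_apply, -finRotate_symm_apply] at h0 h1 h2
  have e1 : ∀ i, u (i, 1) = (1 - z) * u (i, 2) := fun i => by linear_combination -h2 i
  have e0 : ∀ i, u (i, 0) = ((2 - z) * (1 - z) - 1) * u (i, 2) := fun i => by
    linear_combination -h1 i + (2 - z) * e1 i
  have hP := norm_eq_one_of_apply_equiv_eq_mul (finRotate m).symm (w := fun i => u (i, 2))
    (P := (2 - z) * ((2 - z) * (1 - z) - 1) - (1 - z)) (fun h => hu0 ?_)
    (fun i => by linear_combination -h0 i + (2 - z) * e0 i - e1 i)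
  · have := Complex.re_sq_add_im_sq_of_norm_eq_one hP
    simp at this
    simp only [sexticTwo, sexticTwoPoly, Set.mem_ofPred_eq]
    linear_combination this
  · funext ⟨i, j⟩
    have h2' : u (i, 2) = 0 := congrFun h i
    fin_cases j
    · simpa [h2'] using e0 i
    · simpa [h2'] using e1 i
    · exact h2'

/-! ### Weighted rings -/

theorem weightedRingLaplacian_map_mulVec (N : ℕ) (c : ℝ) (u : Fin N → ℂ) (i : Fin N) :
    ((weightedRingLaplacian N c).map ((↑) : ℝ → ℂ)).mulVec u i =
      (u i - u ((finRotate N).symm i)) + c * (u i - u (finRotate N i)) := by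
  rw [weightedRingLaplacian, digraphLaplacian_map_mulVec]
  simp only [weightedRingAdjacency, Matrix.of_apply, Complex.ofReal_add, add_mul,
    Finset.sum_add_distrib, val_eq_succ_mod_iff, ← Equiv.symm_apply_eq]
  congr 1
  · rw [Finset.sum_eq_single ((finRotate N).symm i)]
    · rw [if_pos rfl]; simp
    · intro k _ hk
      rw [if_neg hk.symm]; simp
    · simp
  · rw [Finset.sum_eq_single (finRotate N i)]
    · rw [if_pos (Equiv.symm_apply_apply _ _)]
    · intro k _ hk
      rw [if_neg (fun h => hk ((Equiv.symm_apply_eq _).1 h))]; simp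
    · simp

/-- A Rayleigh quotient suffices: `z = (1 + c) - conj (A / s) - c (A / s)`, where `A` is the
correlation of the eigenvector with its shift and `|A| ≤ s`. Writing `A / s = p + i q` gives `x = (1
+ c)(1 - p)` and `y = (1 - c) q` with `p² + q² ≤ 1`. -/
theorem complexSpectrum_weightedRing_subset {c : ℝ} (hc0 : 0 ≤ c) (hc1 : c ≤ 1) (N : ℕ) :
    complexSpectrum (weightedRingLaplacian N c) ⊆ dropRegion := by
  intro z hz
  obtain ⟨u, hu0, hu⟩ := (mem_complexSpectrum_iff _ _).1 hz
  set σ := finRotate N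
  set s : ℝ := ∑ i, ‖u i‖ ^ 2 with hs
  set A : ℂ := ∑ i, (starRingEnd ℂ) (u i) * u (σ i) with hA
  have hspos : 0 < s := by
    obtain ⟨i, hi⟩ := Function.ne_iff.1 hu0
    exact Finset.sum_pos' (fun i _ => sq_nonneg _)
      ⟨i, Finset.mem_univ i, pow_pos (norm_pos_iff.2 hi) 2⟩
  have hA' : (starRingEnd ℂ) A = ∑ i, (starRingEnd ℂ) (u i) * u (σ.symm i) := by
    rw [hA, map_sum, ← Equiv.sum_comp σ (fun i => (starRingEnd ℂ) (u i) * u (σ.symm i))]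
    exact Finset.sum_congr rfl fun i _ => by simp [mul_comm]
  have hAle : ‖A‖ ≤ s := by
    have h1 : ‖A‖ ≤ ∑ i, ‖u i‖ * ‖u (σ i)‖ :=
      (norm_sum_le _ _).trans_eq (Finset.sum_congr rfl fun i _ => by simp)
    have h2 : ∑ i, ‖u i‖ * ‖u (σ i)‖ ≤ ∑ i, (‖u i‖ ^ 2 + ‖u (σ i)‖ ^ 2) / 2 :=
      Finset.sum_le_sum fun i _ => by nlinarith [sq_nonneg (‖u i‖ - ‖u (σ i)‖)]
    have h3 : ∑ i, (‖u i‖ ^ 2 + ‖u (σ i)‖ ^ 2) / 2 = s := by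
      rw [← Finset.sum_div, Finset.sum_add_distrib, Equiv.sum_comp σ (fun i => ‖u i‖ ^ 2)]
      ring
    linarith
  have hsC : (s : ℂ) = ∑ i, (starRingEnd ℂ) (u i) * u i := by
    rw [hs, Complex.ofReal_sum]
    exact Finset.sum_congr rfl fun i _ => by rw [Complex.conj_mul']; simp
  have hz : z * s = (1 + c) * s - (starRingEnd ℂ) A - c * A := by
    have h1 : ∀ i, (starRingEnd ℂ) (u i) * (z * u i) = (1 + c) * ((starRingEnd ℂ) (u i) * u i)
        - (starRingEnd ℂ) (u i) * u (σ.symm i) - c * ((starRingEnd ℂ) (u i) * u (σ i)) := by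
      intro i
      have := congrFun hu i
      rw [weightedRingLaplacian_map_mulVec, Pi.smul_apply, smul_eq_mul] at this
      rw [← this]
      ring
    have h2 := Finset.sum_congr (rfl : Finset.univ = Finset.univ) fun i _ => h1 i
    rw [Finset.sum_sub_distrib, Finset.sum_sub_distrib, ← Finset.mul_sum, ← Finset.mul_sum, ← hA',
      ← hA, ← hsC] at h2
    rw [← h2, hsC, Finset.mul_sum]
    exact Finset.sum_congr rfl fun i _ => by ring
  have hre := congrArg Complex.re hz
  have him := congrArg Complex.im hz
  simp at hre him
  have hpq : (A.re / s) ^ 2 + (A.im / s) ^ 2 ≤ 1 := by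
    have h1 : A.re ^ 2 + A.im ^ 2 ≤ s ^ 2 := by
      have := Complex.sq_norm A
      rw [Complex.normSq_apply] at this
      nlinarith [norm_nonneg A]
    rw [div_pow, div_pow, ← add_div]
    exact (div_le_one (by positivity)).2 h1
  have hx : z.re = (1 + c) * (1 - A.re / s) := by
    field_simp
    linarith
  have hy : z.im = (1 - c) * (A.im / s) := by
    field_simp
    linarith
  obtain ⟨h1, h2, h3⟩ := abs_le_dropFun hc0 hc1 (p := A.re / s) (y := z.im)
    (by nlinarith [sq_nonneg (A.im / s)]) hx
    (by rw [hy, mul_pow]; nlinarith [sq_nonneg (1 - c)])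
  exact ⟨h1, h2, (abs_le.1 h3).1, (abs_le.1 h3).2⟩

theorem mem_complexSpectrum_weightedRingLaplacian {N : ℕ} (hN : 1 ≤ N) (c : ℝ) {ω : ℂ}
    (hω : ω ^ N = 1) :
    (1 - ω⁻¹) + c * (1 - ω) ∈ complexSpectrum (weightedRingLaplacian N c) := by
  have hω0 : ω ≠ 0 := by
    rintro rfl
    rw [zero_pow (by omega)] at hω
    exact zero_ne_one hω
  have hrot : ∀ i : Fin N, ω ^ (finRotate N i).val = ω * ω ^ i.val := by
    intro i
    rw [(val_eq_succ_mod_iff _ _).2 rfl, ← pow_eq_pow_mod _ hω, pow_succ']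
  have hrot' : ∀ i : Fin N, ω ^ ((finRotate N).symm i).val = ω⁻¹ * ω ^ i.val := by
    intro i
    have := hrot ((finRotate N).symm i)
    rw [Equiv.apply_symm_apply] at this
    rw [this, inv_mul_cancel_left₀ hω0]
  rw [mem_complexSpectrum_iff]
  refine ⟨fun i => ω ^ i.val, fun h => ?_, ?_⟩
  · exact pow_ne_zero _ hω0 (congrFun h ⟨0, hN⟩)
  · funext i
    rw [weightedRingLaplacian_map_mulVec]
    simp only [hrot, hrot', Pi.smul_apply, smul_eq_mul]
    ring

theorem eventually_not_reachesConsensus_weightedRingLaplacian {γ r c : ℝ} (hγ : 0 < γ)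
    (hr : 0 < r) (hc1 : c < 1) :
    ∀ᶠ N : ℕ in atTop, ¬ ReachesConsensus γ r (weightedRingLaplacian N c) := by
  set ω : ℕ → ℂ := fun m => Complex.exp ((2 * Real.pi / m : ℝ) * Complex.I) with hω
  have hωc : Tendsto ω atTop (𝓝 1) := by
    have hc : Continuous fun x : ℝ => Complex.exp (x * Complex.I) := by fun_prop
    simpa [Function.comp_def, hω] using (hc.tendsto 0).comp tendsto_angle_zero
  have hlim : Tendsto (fun N => ((1 - (ω N)⁻¹) + c * (1 - ω N)) / ((2 * Real.pi / N : ℝ) : ℂ)) atTop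
      (𝓝 ((1 - c : ℝ) * Complex.I)) := by
    -- The eigenvalue factors as `(ω⁻¹ - c)(ω - 1)`.
    have h1 := ((hωc.inv₀ one_ne_zero).sub_const (c : ℂ)).mul tendsto_exp_sub_one_div
    rw [inv_one] at h1
    rw [Complex.ofReal_sub, Complex.ofReal_one]
    refine h1.congr fun N => ?_
    have h0 : ω N ≠ 0 := Complex.exp_ne_zero _
    change ((ω N)⁻¹ - c) * ((ω N - 1) / _) = _
    rw [← mul_div_assoc]
    congr 1
    field_simp
    ring
  filter_upwards [eventually_notMem_consensusRegion hγ hr (sub_pos.2 hc1).ne' eventually_angle_pos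
    tendsto_angle_zero hlim, eventually_ge_atTop 1] with N hN h1
  refine not_reachesConsensus_of_mem_spectrum hγ _ ?_ hN.1 hN.2
  exact mem_complexSpectrum_weightedRingLaplacian h1 c (exp_angle_pow_eq_one h1)

/-! ### The curves near the origin -/

/-- A curve given near the origin by `y² b(x, y) = x a(x, y)`, with `a` and `b` positive there,
leaves the consensus region at the origin when reflected. -/
theorem leavesConsensusRegionAtOrigin_reflectScale {γ r : ℝ} (hγ : 0 < γ) (hr : 0 < r) {K : Set ℂ}
    {a b : ℝ → ℝ → ℝ} (ha : Continuous fun p : ℝ × ℝ => a p.1 p.2)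
    (hb : Continuous fun p : ℝ × ℝ => b p.1 p.2) (ha0 : 0 < a 0 0) (hb0 : 0 < b 0 0)
    {ρ : ℝ} (hρ : 0 < ρ)
    (hK : ∀ x y : ℝ, |x| < ρ → |y| < ρ → ((⟨x, y⟩ : ℂ) ∈ K ↔ y ^ 2 * b x y = x * a x y)) :
    LeavesConsensusRegionAtOrigin γ (reflectScale r K) := by
  have hev : ∀ᶠ p : ℝ × ℝ in 𝓝 (0, 0), a 0 0 / 2 < a p.1 p.2 ∧ a p.1 p.2 < 2 * a 0 0 ∧
      b 0 0 / 2 < b p.1 p.2 ∧ b p.1 p.2 < 2 * b 0 0 := by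
    have h1 := ha.tendsto (0, 0)
    have h2 := hb.tendsto (0, 0)
    filter_upwards [h1.eventually (lt_mem_nhds (half_lt_self ha0)),
      h1.eventually (gt_mem_nhds (by linarith : a 0 0 < 2 * a 0 0)),
      h2.eventually (lt_mem_nhds (half_lt_self hb0)),
      h2.eventually (gt_mem_nhds (by linarith : b 0 0 < 2 * b 0 0))] with p h1 h2 h3 h4
    exact ⟨h1, h2, h3, h4⟩
  obtain ⟨τ', hτ', hball⟩ := Metric.eventually_nhds_iff.1 hev
  obtain ⟨τ, hτ, hτρ, hab⟩ : ∃ τ > 0, τ ≤ ρ ∧ ∀ x y : ℝ, |x| < τ → |y| < τ →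
      a 0 0 / 2 < a x y ∧ a x y < 2 * a 0 0 ∧ b 0 0 / 2 < b x y ∧ b x y < 2 * b 0 0 := by
    refine ⟨min τ' ρ, lt_min hτ' hρ, min_le_right _ _, fun x y hx hy => ?_⟩
    refine hball (y := (x, y)) ?_
    rw [Prod.dist_eq]
    simp only [Real.dist_eq, sub_zero]
    exact max_lt (hx.trans_le (min_le_left _ _)) (hy.trans_le (min_le_left _ _))
  refine ⟨⟨0, ?_, by simp⟩, ?_, ?_⟩
  · have := (hK 0 0 (by simpa using hρ) (by simpa using hρ)).2 (by simp)
    exact this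
  · intro ε hε
    obtain ⟨e, he, heτ, heε⟩ : ∃ e > 0, e < τ ∧ r * e < ε := by
      refine ⟨min (τ / 2) (ε / (2 * r)), by positivity, ?_, ?_⟩
      · exact (min_le_left _ _).trans_lt (half_lt_self hτ)
      · calc r * min (τ / 2) (ε / (2 * r)) ≤ r * (ε / (2 * r)) :=
              mul_le_mul_of_nonneg_left (min_le_right _ _) hr.le
          _ = ε / 2 := by field_simp
          _ < ε := half_lt_self hε
    -- For `x' < η` the bounds `b > b(0,0)/2` and `a < 2 a(0,0)` make `y² b - x' a` positive at `y =
    -- -e`, while it is negative at `y = 0`. The zero is sought at `y < 0` because multiplication by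
    -- `-r` makes it positive.
    set η : ℝ := min τ (e ^ 2 * b 0 0 / (4 * a 0 0)) with hη
    have hηpos : 0 < η := by positivity
    refine ⟨r * η, by positivity, fun x hx1 hx2 => ?_⟩
    obtain ⟨x', rfl⟩ : ∃ x', x = -r * x' := ⟨-x / r, by field_simp⟩
    have hx'0 : 0 < x' := by nlinarith
    have hx'η : x' < η := by nlinarith
    have hx'τ : |x'| < τ := by
      rw [abs_of_pos hx'0]; exact hx'η.trans_le (min_le_left _ _)
    have hx'e : x' * (4 * a 0 0) < e ^ 2 * b 0 0 :=
      (lt_div_iff₀ (by positivity)).1 (hx'η.trans_le (min_le_right _ _))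
    have hcont : ContinuousOn (fun y => y ^ 2 * b x' y - x' * a x' y) (Set.Icc (-e) 0) := by
      have h1 : Continuous fun y => a x' y := ha.comp (Continuous.prodMk_right x')
      have h2 : Continuous fun y => b x' y := hb.comp (Continuous.prodMk_right x')
      fun_prop
    obtain ⟨-, h2, -, -⟩ := hab x' (-e) hx'τ (by rw [abs_neg, abs_of_pos he]; exact heτ)
    obtain ⟨-, -, h3, -⟩ := hab x' (-e) hx'τ (by rw [abs_neg, abs_of_pos he]; exact heτ)
    obtain ⟨h4, -, -, -⟩ := hab x' 0 hx'τ (by simpa using hτ)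
    have hval0 : x' * a x' 0 > 0 := mul_pos hx'0 (by linarith)
    obtain ⟨y, hy, hy0⟩ := intermediate_value_Icc' (by linarith : -e ≤ 0) hcont
      (show (0 : ℝ) ∈ Set.Icc (0 ^ 2 * b x' 0 - x' * a x' 0)
          ((-e) ^ 2 * b x' (-e) - x' * a x' (-e)) from ⟨by nlinarith, by
        have := mul_lt_mul_of_pos_left h2 hx'0
        have := mul_lt_mul_of_pos_left h3 (pow_pos he 2)
        nlinarith⟩)
    have hyne : y ≠ 0 := by
      rintro rfl
      simp only at hy0
      nlinarith
    have hyneg : y < 0 := lt_of_le_of_ne hy.2 hyne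
    refine ⟨-r * y, by nlinarith, by nlinarith [hy.1], ⟨⟨x', y⟩, ?_, ?_⟩⟩
    · refine (hK x' y (hx'τ.trans_le hτρ) ?_).2 (sub_eq_zero.1 hy0)
      rw [abs_of_neg hyneg]
      linarith [hy.1]
    · apply Complex.ext <;> simp
  · set k : ℝ := r * (a 0 0 / (4 * b 0 0)) with hk
    have hkpos : 0 < k := by positivity
    -- With `X = r x`, `Y = -r y`, the curve equation gives `Y² ≥ k X`. The four bounds keep the
    -- preimage in the box, make `1 - γ² X > 1/2`, give `X < 1`, and give `γ² X < k/4`. Then `γ² X³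
    -- < k X / 4 < k X / 2 ≤ Y² (1 - γ² X)`.
    refine ⟨min (r * τ) (min (1 / (2 * γ ^ 2)) (min 1 (k / (4 * γ ^ 2)))), by positivity, ?_⟩
    rintro _ ⟨⟨x, y⟩, hw, rfl⟩ hz0 hzδ
    have hcoe : -(r : ℂ) * ⟨x, y⟩ = ⟨-r * x, -r * y⟩ := by apply Complex.ext <;> simp
    simp only [hcoe] at hz0 hzδ ⊢
    simp only [lt_min_iff] at hzδ
    obtain ⟨hδ1, hδ2, hδ3, hδ4⟩ := hzδ
    have hre := Complex.abs_re_le_norm ⟨-r * x, -r * y⟩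
    have him := Complex.abs_im_le_norm ⟨-r * x, -r * y⟩
    simp only at hre him
    have hx : |x| < τ := by
      have : r * |x| < r * τ := by
        rw [abs_mul, abs_neg, abs_of_pos hr] at hre; linarith
      exact lt_of_mul_lt_mul_left this hr.le
    have hy : |y| < τ := by
      have : r * |y| < r * τ := by
        rw [abs_mul, abs_neg, abs_of_pos hr] at him; linarith
      exact lt_of_mul_lt_mul_left this hr.le
    obtain ⟨h1, h2, h3, h4⟩ := hab x y hx hy
    have hapos : 0 < a x y := by linarith
    have hbpos : 0 < b x y := by linarith
    have heq := (hK x y (hx.trans_le hτρ) (hy.trans_le hτρ)).1 hw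
    have hx0 : 0 < x := by
      have h5 : 0 ≤ x * a x y := by rw [← heq]; positivity
      rcases (nonneg_of_mul_nonneg_left h5 hapos).lt_or_eq with h | h
      · exact h
      · exfalso
        have heq0 : y ^ 2 * b x y = 0 := by rw [heq, ← h, zero_mul]
        have : y = 0 := by simpa [hbpos.ne'] using heq0
        exact hz0 (by simp [← h, this]; rfl)
    have hyx : k * (r * x) ≤ (-r * y) ^ 2 := by
      have h5 : x * (a 0 0 / 2) ≤ y ^ 2 * (2 * b 0 0) := by
        have := mul_le_mul_of_nonneg_left h1.le hx0.le
        have := mul_le_mul_of_nonneg_left h4.le (sq_nonneg y)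
        linarith
      have h6 : x * (a 0 0 / (4 * b 0 0)) ≤ y ^ 2 := by
        rw [← mul_div_assoc, div_le_iff₀ (by positivity)]
        linarith
      calc k * (r * x) = r ^ 2 * (x * (a 0 0 / (4 * b 0 0))) := by rw [hk]; ring
        _ ≤ r ^ 2 * y ^ 2 := mul_le_mul_of_nonneg_left h6 (sq_nonneg r)
        _ = (-r * y) ^ 2 := by ring
    obtain ⟨X, hX⟩ : ∃ X, X = r * x := ⟨_, rfl⟩
    obtain ⟨Y, hY⟩ : ∃ Y, Y = -r * y := ⟨_, rfl⟩
    have hX' : -r * x = -X := by rw [hX]; ring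
    rw [hX', ← hY] at hre
    rw [hX', ← hY] at him hδ2 hδ3 hδ4 ⊢
    rw [← hX, ← hY] at hyx
    have hX0 : 0 < X := by rw [hX]; positivity
    rw [abs_neg, abs_of_pos hX0] at hre
    have hX2 : γ ^ 2 * X < 1 / 2 := by
      have := (lt_div_iff₀ (by positivity)).1 (hre.trans_lt hδ2)
      linarith
    have hX4 : γ ^ 2 * X < k / 4 := by
      have := (lt_div_iff₀ (by positivity)).1 (hre.trans_lt hδ4)
      linarith
    have hX1 : X < 1 := hre.trans_lt hδ3
    have hden : 0 < γ ^ 2 * -X + 1 := by linarith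
    have hmain : γ ^ 2 * X ^ 3 < Y ^ 2 * (γ ^ 2 * -X + 1) := by
      have h7 : γ ^ 2 * X ^ 3 < k / 4 * X := by
        have h8 : γ ^ 2 * X * X ^ 2 ≤ γ ^ 2 * X * X :=
          mul_le_mul_of_nonneg_left (by nlinarith) (by positivity)
        have h9 := mul_lt_mul_of_pos_right hX4 hX0
        nlinarith
      have h10 : k * X * (1 / 2) ≤ Y ^ 2 * (γ ^ 2 * -X + 1) :=
        mul_le_mul hyx (by linarith) (by norm_num) (sq_nonneg Y)
      nlinarith [mul_pos hkpos hX0]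
    refine ⟨by simpa using hX0, hden, ?_, ?_⟩
    · rw [div_lt_iff₀ hden]
      linarith
    · rw [mem_consensusRegion_iff hγ, hurwitzForm]
      simp only
      linarith

/-! ### The five curves in the form `y² b = x a` -/

theorem unitCircleAtOne_leaves {γ r : ℝ} (hγ : 0 < γ) (hr : 0 < r) :
    LeavesConsensusRegionAtOrigin γ (reflectScale r unitCircleAtOne) := by
  refine leavesConsensusRegionAtOrigin_reflectScale hγ hr (a := fun x _ => 2 - x)
    (b := fun _ _ => 1) (by fun_prop) (by fun_prop) (by norm_num) one_pos one_pos
    fun x y _ _ => ?_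
  simp only [unitCircleAtOne, Set.mem_ofPred_eq]
  constructor <;> intro h <;> linarith

/-- For this curve and the two sextics, `x a` is minus the defining polynomial restricted to the
real axis, and `y² b` collects the remaining terms, all divisible by `y²`. -/
theorem cassiniOvals_leaves {γ r : ℝ} (hγ : 0 < γ) (hr : 0 < r) :
    LeavesConsensusRegionAtOrigin γ (reflectScale r cassiniOvals) := by
  refine leavesConsensusRegionAtOrigin_reflectScale hγ hr
    (a := fun x _ => (12 - 4 * x) * (8 - 12 * x + 4 * x ^ 2))
    (b := fun x y => 112 + 8 * (4 * x ^ 2 - 12 * x) + 16 * y ^ 2)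
    (by fun_prop) (by fun_prop) (by norm_num) (by norm_num) one_pos fun x y _ _ => ?_
  have h5 : √5 ^ 2 = (5 : ℝ) := Real.sq_sqrt (by norm_num)
  simp only [cassiniOvals, Set.mem_ofPred_eq]
  constructor <;> intro h
  · linear_combination h
      - ((√5 ^ 2 + 5) - 2 * ((2 * (x - 3 / 2)) ^ 2 - (2 * y) ^ 2)) * h5
  · linear_combination h
      + ((√5 ^ 2 + 5) - 2 * ((2 * (x - 3 / 2)) ^ 2 - (2 * y) ^ 2)) * h5

theorem sexticOne_leaves {γ r : ℝ} (hγ : 0 < γ) (hr : 0 < r) :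
    LeavesConsensusRegionAtOrigin γ (reflectScale r sexticOne) := by
  refine leavesConsensusRegionAtOrigin_reflectScale hγ hr
    (a := fun x _ => (x - 2) ^ 2 * (2 - (x - 2) ^ 2 * x))
    (b := fun x y => 3 * (x - 2) ^ 4 + 3 * (x - 2) ^ 2 * y ^ 2 + y ^ 4
      + (4 + 4 * (x - 2)) * (2 * (x - 2) ^ 2 + y ^ 2) + 6 * (x - 2) + 4)
    (by fun_prop) (by fun_prop) (by norm_num) (by norm_num) one_pos fun x y _ _ => ?_
  simp only [sexticOne, sexticOnePoly, Set.mem_ofPred_eq]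
  constructor <;> intro h <;> linear_combination h

theorem sexticTwo_leaves {γ r : ℝ} (hγ : 0 < γ) (hr : 0 < r) :
    LeavesConsensusRegionAtOrigin γ (reflectScale r sexticTwo) := by
  refine leavesConsensusRegionAtOrigin_reflectScale hγ hr
    (a := fun x _ => -((x - 1) * ((x - 2) ^ 2 - 2) * (x - 2) * (x - 3)))
    (b := fun x y => 3 * (x - 2) ^ 4 + 3 * (x - 2) ^ 2 * y ^ 2 + y ^ 4
      + 2 * (x - 2) * (2 * (x - 2) ^ 2 + y ^ 2) + 2 * (x - 2) ^ 2 + 2 * (x - 2) + 5 * y ^ 2 + 6)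
    (by fun_prop) (by fun_prop) (by norm_num) (by norm_num) one_pos fun x y _ _ => ?_
  simp only [sexticTwo, sexticTwoPoly, Set.mem_ofPred_eq]
  constructor <;> intro h <;> linear_combination h

/-- For `|x| < 1` only the circular branch of `dropFun` matters, so `a` and `b` are those of the
unit circle. -/
theorem dropCurve_leaves {γ r : ℝ} (hγ : 0 < γ) (hr : 0 < r) :
    LeavesConsensusRegionAtOrigin γ (reflectScale r dropCurve) := by
  refine leavesConsensusRegionAtOrigin_reflectScale hγ hr (a := fun x _ => 2 - x)
    (b := fun _ _ => 1) (by fun_prop) (by fun_prop) (by norm_num) one_pos one_pos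
    fun x y hx _ => ?_
  have hx1 := (abs_lt.1 hx).2
  simp only [dropCurve, Set.mem_ofPred_eq, ← sq_eq_sq_iff_eq_or_eq_neg]
  constructor
  · rintro ⟨h0, -, h⟩
    rw [dropFun_sq_of_le h0 (by linarith)] at h
    linarith
  · intro h
    have h0 : 0 ≤ x := by nlinarith [sq_nonneg y]
    refine ⟨h0, by linarith, ?_⟩
    rw [dropFun_sq_of_le h0 (by linarith)]
    linarith

theorem corollary3 (γ r : ℝ) (hγ : 0 < γ) (hr : 0 < r) :
    -- ring digraphs whose Laplacian spectra lie in one of the five sets do not reach consensus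
    -- once they have many nodes
    (∀ (n : ℕ) (S : Finset ℕ) (K : Set ℂ), 1 ≤ n →
      K ∈ ({unitCircleAtOne, cassiniOvals, sexticOne, sexticTwo, dropRegion} : Set (Set ℂ)) →
      (∀ m : ℕ, 1 ≤ m → complexSpectrum (ringLaplacian m n S) ⊆ K) →
      ∀ᶠ m : ℕ in Filter.atTop, ¬ ReachesConsensus γ r (ringLaplacian m n S)) ∧
    -- neither does the weighted ring
    (∀ c : ℝ, 0 ≤ c → c < 1 →
      ∀ᶠ N : ℕ in Filter.atTop, ¬ ReachesConsensus γ r (weightedRingLaplacian N c)) ∧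
    -- the five topologies do have their Laplacian spectra in the five sets
    (∀ m : ℕ, 1 ≤ m →
      complexSpectrum (ringLaplacian m 1 ∅) ⊆ unitCircleAtOne ∧
      complexSpectrum (ringLaplacian m 2 {0}) ⊆ cassiniOvals ∧
      complexSpectrum (ringLaplacian m 3 {0}) ⊆ sexticOne ∧
      complexSpectrum (ringLaplacian m 3 {0, 1}) ⊆ sexticTwo) ∧
    (∀ (c : ℝ) (N : ℕ), 0 ≤ c → c ≤ 1 → 1 ≤ N →
      complexSpectrum (weightedRingLaplacian N c) ⊆ dropRegion) ∧
    -- the consensus region is bounded by the curve `y² = - γ² x³ / (γ² x + 1)`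
    frontier (consensusRegion (relativeVelocityVariable γ)) = boundaryCurve γ ∧
    -- near the origin each spectral curve leaves the consensus region
    (∀ K ∈ ({unitCircleAtOne, cassiniOvals, sexticOne, sexticTwo, dropCurve} : Set (Set ℂ)),
      LeavesConsensusRegionAtOrigin γ (reflectScale r K)) := by
  refine ⟨fun n S _ hn _ _ => eventually_not_reachesConsensus_ringLaplacian hγ hr hn S,
    fun c _ hc1 => eventually_not_reachesConsensus_weightedRingLaplacian hγ hr hc1,
    fun m _ => ⟨complexSpectrum_ring_one_subset m, complexSpectrum_ring_two_subset m,
      complexSpectrum_ring_three_one_subset m, complexSpectrum_ring_three_two_subset m⟩,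
    fun c N hc0 hc1 _ => complexSpectrum_weightedRing_subset hc0 hc1 N,
    frontier_consensusRegion hγ, ?_⟩
  rintro K (rfl | rfl | rfl | rfl | rfl)
  · exact unitCircleAtOne_leaves hγ hr
  · exact cassiniOvals_leaves hγ hr
  · exact sexticOne_leaves hγ hr
  · exact sexticTwo_leaves hγ hr
  · exact dropCurve_leaves hγ hr
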